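/- Let $\mathbb F_q$ be the finite field with $q$ elements, let $s\ge 3$, and let $c_1,\dots,c_s\in\mathbb F_q[t]\setminus\{0\}$ satisfy $c_1+\cdots+c_s=0$. The genus $m$ of the equation \[ c_1x_1+\cdots+c_sx_s=0 \qquad (*) \] is the largest number $m$ for which there is a partition of $\{1,\dots,s\}$ into $m$ disjoint nonempty sets $T_1,\dots,T_m$ with $\sum_{i\in T_j}c_i=0$ for every $j$ (so $m\ge 1$). A solution $(x_1,\dots,x_s)$ of $(*)$ is called trivial if, for some such partition into $m$ (the genus) sets, $x_i=x_{i'}$ whenever $i,i'$ lie in the same $T_j$. For $N\ge 1$ let $G_N=\{x\in\mathbb F_q[t]:\deg x<N\}$, and let $r(N)$ be the size of the largest subset $A\subseteq G_N$ such that every solution of $(*)$ with $x_1,\dots,x_s\in A$ is trivial. Then there is a constant $C>0$, depending only on $s$, $q$ and $\ell=\max_i\deg c_i$, such that for all $N\ge 2$ \[ r(N)\le C\,q^N\left(\frac{(\log N)^4}{N}\right)^{s-2}. \] -/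

import Mathlib

open Polynomial

/-- `P` is a partition of the index set into nonempty sets on each of which the coefficients
sum to zero. -/
def IsZeroSumPartition {R : Type*} [CommRing R] {s : ℕ} (c : Fin s → R)
    (P : Finpartition (Finset.univ : Finset (Fin s))) : Prop :=
  ∀ T ∈ P.parts, ∑ i ∈ T, c i = 0

/-- The genus of the equation `c₁ x₁ + ⋯ + cₛ xₛ = 0`: the largest number of parts of a
partition of the index set into nonempty sets with zero coefficient sum. -/
noncomputable def genus {R : Type*} [CommRing R] {s : ℕ} (c : Fin s → R) : ℕ :=
  sSup {m : ℕ | ∃ P : Finpartition (Finset.univ : Finset (Fin s)),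
    IsZeroSumPartition c P ∧ P.parts.card = m}

/-- The trivial solutions of an equation of genus `m`: those which are constant on every part of
some partition of the index set into `m` nonempty sets with zero coefficient sum. -/
def IsTrivialSolution {R : Type*} [CommRing R] {s : ℕ} (c : Fin s → R) (x : Fin s → R) : Prop :=
  ∃ P : Finpartition (Finset.univ : Finset (Fin s)),
    IsZeroSumPartition c P ∧ P.parts.card = genus c ∧
      ∀ T ∈ P.parts, ∀ i ∈ T, ∀ j ∈ T, x i = x j

/-- Every solution of `c₁ x₁ + ⋯ + cₛ xₛ = 0` with all `xᵢ ∈ A` is trivial. -/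
def HasNoNontrivialSolution {R : Type*} [CommRing R] {s : ℕ} (c : Fin s → R)
    (A : Finset R) : Prop :=
  ∀ x : Fin s → R, (∀ i, x i ∈ A) → ∑ i, c i * x i = 0 → IsTrivialSolution c x

/-- `r(N)`: the size of the largest set of polynomials over `F` of degree strictly less than `N`
with no nontrivial solution to `c₁ x₁ + ⋯ + cₛ xₛ = 0`. -/
noncomputable def maxSolutionFree {F : Type*} [Field F] {s : ℕ} (c : Fin s → F[X]) (N : ℕ) : ℕ :=
  sSup {n : ℕ | ∃ A : Finset F[X], (∀ a ∈ A, a ∈ degreeLT F N) ∧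
    HasNoNontrivialSolution c A ∧ A.card = n}

/-- For a translation invariant equation the supremum defining the genus is a maximum. -/
theorem isGreatest_genus {R : Type*} [CommRing R] {s : ℕ} (c : Fin s → R) (hs : 1 ≤ s)
    (hc : ∑ i, c i = 0) :
    IsGreatest {m : ℕ | ∃ P : Finpartition (Finset.univ : Finset (Fin s)),
      IsZeroSumPartition c P ∧ P.parts.card = m} (genus c) := by
  have hb : BddAbove {m : ℕ | ∃ P : Finpartition (Finset.univ : Finset (Fin s)),
      IsZeroSumPartition c P ∧ P.parts.card = m} := by
    refine ⟨s, ?_⟩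
    rintro _ ⟨P, _, rfl⟩
    simpa using P.card_parts_le_card
  have hne : (Finset.univ : Finset (Fin s)) ≠ ⊥ := by
    have : (⟨0, hs⟩ : Fin s) ∈ (Finset.univ : Finset (Fin s)) := Finset.mem_univ _
    exact Finset.ne_empty_of_mem this
  refine ⟨Nat.sSup_mem ⟨1, Finpartition.indiscrete hne, ?_, ?_⟩ hb, fun m hm => le_csSup hb hm⟩
  · intro T hT
    have : T = Finset.univ := by simpa [Finpartition.indiscrete] using hT
    rw [this, hc]
  · simp [Finpartition.indiscrete]

/-- Over a finite field the supremum defining `r(N)` is a maximum. -/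
theorem isGreatest_maxSolutionFree {F : Type*} [Field F] [Finite F] {s : ℕ} (hs : 1 ≤ s)
    (c : Fin s → F[X]) (N : ℕ) :
    IsGreatest {n : ℕ | ∃ A : Finset F[X], (∀ a ∈ A, a ∈ degreeLT F N) ∧
      HasNoNontrivialSolution c A ∧ A.card = n} (maxSolutionFree c N) := by
  have hfin : (degreeLT F N : Set F[X]).Finite := by
    have : Finite (degreeLT F N) := Finite.of_equiv _ (degreeLTEquiv F N).toEquiv.symm
    exact Set.toFinite _
  have hb : BddAbove {n : ℕ | ∃ A : Finset F[X], (∀ a ∈ A, a ∈ degreeLT F N) ∧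
      HasNoNontrivialSolution c A ∧ A.card = n} := by
    refine ⟨hfin.toFinset.card, ?_⟩
    rintro _ ⟨A, hA, _, rfl⟩
    exact Finset.card_le_card fun a ha => by simpa using hA a ha
  refine ⟨Nat.sSup_mem ⟨0, ∅, by simp, ?_, rfl⟩ hb, fun m hm => le_csSup hb hm⟩
  intro x hx
  exact absurd (hx ⟨0, hs⟩) (Finset.notMem_empty _)

/-! The bound proved is exponential: `r(N) ≤ K σ ^ N` with `σ < q`, which beats any fixed power of
`1 / N`; the logarithms enter only to match the stated form. If some minimal zero-sum set of
coefficients has at least three elements, give two of its variables the values `u`, `v` and all the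
others `w`. Minimality leaves only `u = v = w`, so `A` yields a tricoloured sum-free set among
coefficient vectors in `F ^ (N + ℓ)`, and the slice rank method bounds it by `3 ρ ^ (N + ℓ)` with `ρ
< q`. Otherwise, since no coefficient is zero, there are two disjoint pairs of opposite
coefficients. Then `c i * a + c j * b` takes each value at most twice on pairs `a ≠ b` from `A`, so
`|A|` is of order at most `√q ^ (N + ℓ)`. Either argument uses part of the variables; the others
receive a fresh element of `A` (`HasNoNontrivialSolution.exists_part`). -/

/-! ### Counting exponent vectors of low weight -/

open Finset in
/-- The exponent vectors in `{0, …, n}^M` of weight at most a third of the maximum. -/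
def lowExponents (n M : ℕ) : Finset (Fin M → ℕ) :=
  {e ∈ Fintype.piFinset fun _ : Fin M => range (n + 1) | 3 * ∑ j, e j ≤ n * M}

/-- Exponential Markov inequality: as `r ≤ 1`, a low vector has `r ^ (3 * ∑ e) ≥ r ^ (n * M)`, and
the sum of these weights over the whole box factorises. -/
theorem lowExponents_card_mul_le (n M : ℕ) {r : ℝ} (h0 : 0 < r) (h1 : r ≤ 1) :
    ((lowExponents n M).card : ℝ) * (r ^ n) ^ M ≤ (∑ i ∈ Finset.range (n + 1), r ^ (3 * i)) ^ M := by
  calc ((lowExponents n M).card : ℝ) * (r ^ n) ^ M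
      = ∑ e ∈ lowExponents n M, (r ^ n) ^ M := by simp
    _ ≤ ∑ e ∈ lowExponents n M, ∏ j, r ^ (3 * e j) := by
        refine Finset.sum_le_sum fun e he => ?_
        rw [Finset.prod_pow_eq_pow_sum, ← Finset.mul_sum, ← pow_mul]
        exact pow_le_pow_of_le_one h0.le h1 (Finset.mem_filter.1 he).2
    _ ≤ ∑ e ∈ Fintype.piFinset fun _ : Fin M => Finset.range (n + 1), ∏ j, r ^ (3 * e j) :=
        Finset.sum_le_sum_of_subset_of_nonneg (Finset.filter_subset _ _)
          fun _ _ _ => Finset.prod_nonneg fun _ _ => by positivity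
    _ = (∑ i ∈ Finset.range (n + 1), r ^ (3 * i)) ^ M := by
        rw [Finset.sum_prod_piFinset (Finset.range (n + 1)) fun (_ : Fin M) i => r ^ (3 * i)]
        simp

/-- Both sides equal `n + 1` at `r = 1`, where the left has derivative `3n(n + 1)/2` and the right
only `n(n + 1)`; hence the inequality holds just below `1`. -/
theorem exists_sum_pow_lt {n : ℕ} (hn : 0 < n) :
    ∃ r : ℝ, 0 < r ∧ r < 1 ∧ ∑ i ∈ Finset.range (n + 1), r ^ (3 * i) < (n + 1) * r ^ n := by
  let φ : ℝ → ℝ := fun r => ∑ i ∈ Finset.range (n + 1), r ^ (3 * i) - (n + 1) * r ^ n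
  have hd : HasDerivAt φ (∑ i ∈ Finset.range (n + 1), ((3 * i : ℕ) : ℝ) * 1 ^ (3 * i - 1)
      - (n + 1) * (n * 1 ^ (n - 1))) 1 := by
    refine HasDerivAt.sub ?_ ((hasDerivAt_pow n (1 : ℝ)).const_mul _)
    exact HasDerivAt.fun_sum fun i _ => hasDerivAt_pow (3 * i) (1 : ℝ)
  have hs : ∑ i ∈ Finset.range (n + 1), (i : ℝ) = n * (n + 1) / 2 := by
    have := Finset.sum_range_id_mul_two (n + 1)
    rw [Nat.add_sub_cancel] at this
    have h2 := congrArg (Nat.cast (R := ℝ)) this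
    push_cast at h2
    linarith
  have hpos : 0 < ∑ i ∈ Finset.range (n + 1), ((3 * i : ℕ) : ℝ) * 1 ^ (3 * i - 1)
      - (n + 1) * (n * 1 ^ (n - 1)) := by
    have hn' : (0 : ℝ) < n := by exact_mod_cast hn
    simp only [one_pow, mul_one, Nat.cast_mul, Nat.cast_ofNat, ← Finset.mul_sum, hs]
    nlinarith
  have hφ : φ 1 = 0 := by simp [φ]
  have hev : ∀ᶠ r in nhdsWithin (1 : ℝ) (Set.Iio 1), 0 < slope φ 1 r :=
    (hasDerivAt_iff_tendsto_slope_left_right.1 hd).1.eventually (lt_mem_nhds hpos)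
  have hIoo : Set.Ioo (0 : ℝ) 1 ∈ nhdsWithin (1 : ℝ) (Set.Iio 1) :=
    Ioo_mem_nhdsLT one_pos
  obtain ⟨r, hr, hr01⟩ := (hev.and hIoo).exists
  refine ⟨r, hr01.1, hr01.2, ?_⟩
  rw [slope_def_field, hφ, sub_zero] at hr
  have : φ r < 0 := by
    by_contra! h
    exact absurd hr (not_lt.2 (div_nonpos_of_nonneg_of_nonpos h (sub_neg.2 hr01.2).le))
  simpa [φ] using this

/-- For `n > 0` the number of low exponent vectors is exponentially smaller than `(n + 1) ^ M`. -/
theorem exists_lowExponents_card_le {n : ℕ} (hn : 0 < n) :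
    ∃ ρ : ℝ, 0 < ρ ∧ ρ < n + 1 ∧ ∀ M, ((lowExponents n M).card : ℝ) ≤ ρ ^ M := by
  obtain ⟨r, h0, h1, hr⟩ := exists_sum_pow_lt hn
  have hrn : 0 < r ^ n := by positivity
  refine ⟨(∑ i ∈ Finset.range (n + 1), r ^ (3 * i)) / r ^ n, div_pos ?_ hrn,
    (div_lt_iff₀ hrn).2 hr, fun M => ?_⟩
  · exact Finset.sum_pos (fun _ _ => by positivity) ⟨0, by simp⟩
  · rw [div_pow, le_div_iff₀ (by positivity)]
    exact lowExponents_card_mul_le n M h0 h1.le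

/-! ### Linear algebra and slice rank -/

/-- A subspace of a function space contains a vector whose support is at least as large as the
dimension. -/
theorem Submodule.exists_finrank_le_card_support {K α : Type*} [Field K] [Fintype α]
    [DecidableEq K] (V : Submodule K (α → K)) :
    ∃ v ∈ V, Module.finrank K V ≤ (Finset.univ.filter fun a => v a ≠ 0).card := by
  classical
  let supp : (α → K) → Finset α := fun v => Finset.univ.filter fun a => v a ≠ 0
  obtain ⟨n, hn, hmax⟩ : ∃ n, (∃ v ∈ V, (supp v).card = n) ∧ ∀ w ∈ V, (supp w).card ≤ n := by
    have hb : BddAbove {n | ∃ v ∈ V, (supp v).card = n} :=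
      ⟨Fintype.card α, by rintro _ ⟨v, _, rfl⟩; exact Finset.card_le_univ _⟩
    have hne : {n | ∃ v ∈ V, (supp v).card = n}.Nonempty := ⟨_, 0, V.zero_mem, rfl⟩
    exact ⟨_, Nat.sSup_mem hne hb, fun w hw => le_csSup hb ⟨w, hw, rfl⟩⟩
  obtain ⟨v, hv, rfl⟩ := hn
  refine ⟨v, hv, ?_⟩
  by_contra! hlt
  -- Restriction of `V` to a maximal support that is too small has a kernel; adding a nonzero kernel
  -- element to `v` enlarges the support.
  let res : V →ₗ[K] (supp v → K) := (LinearMap.funLeft K K Subtype.val).comp V.subtype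
  have hker : res.ker ≠ ⊥ := LinearMap.ker_ne_bot_of_finrank_lt (by simpa using hlt)
  obtain ⟨w, hw, hw0⟩ := (Submodule.ne_bot_iff _).1 hker
  have hwv : ∀ a, v a ≠ 0 → (w : α → K) a = 0 := fun a ha =>
    congrFun (LinearMap.mem_ker.1 hw) (⟨a, by simp [supp, ha]⟩ : supp v)
  have hw1 : (w : α → K) ≠ 0 := fun h => hw0 (Subtype.ext h)
  obtain ⟨a, ha⟩ := Function.ne_iff.1 hw1
  have hss : supp v ⊂ supp (v + w) := by
    refine Finset.ssubset_iff_of_subset (fun b hb => ?_) |>.2 ⟨a, ?_, ?_⟩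
    · have hb' : v b ≠ 0 := by simpa [supp] using hb
      simpa [supp, hwv b hb'] using hb'
    · have : v a = 0 := by
        by_contra h
        exact ha (hwv a h)
      simpa [supp, this] using ha
    · intro h
      exact ha (hwv a (by simpa [supp] using h))
  exact absurd (hmax _ (V.add_mem hv w.2)) (not_le.2 (Finset.card_lt_card hss))

/-- Given fewer functions than points, some function orthogonal to all of them has large support. -/
theorem exists_orthogonal_large_support {K α ι : Type*} [Field K] [Fintype α]
    [DecidableEq K] (S : Finset ι) (X : ι → α → K) :
    ∃ w : α → K, (∀ e ∈ S, ∑ a, w a * X e a = 0) ∧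
      Fintype.card α ≤ (Finset.univ.filter fun a => w a ≠ 0).card + S.card := by
  classical
  let T : (α → K) →ₗ[K] (S → K) :=
    LinearMap.pi fun e => ∑ a, X e a • LinearMap.proj a
  obtain ⟨w, hw, hcard⟩ := T.ker.exists_finrank_le_card_support
  refine ⟨w, fun e he => ?_, ?_⟩
  · have := congrFun (LinearMap.mem_ker.1 hw) ⟨e, he⟩
    simpa [T, mul_comm] using this
  · have h1 := T.finrank_range_add_finrank_ker
    have h2 := T.range.finrank_le
    simp only [Module.finrank_fintype_fun_eq_card, Fintype.card_coe] at h1 h2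
    omega

theorem Matrix.rank_add_le_rank_add_rank {K m n : Type*} [Field K] [Fintype m] [Fintype n]
    (A B : Matrix m n K) : (A + B).rank ≤ A.rank + B.rank := by
  have h : LinearMap.range (A + B).mulVecLin ≤
      LinearMap.range A.mulVecLin ⊔ LinearMap.range B.mulVecLin := by
    rintro _ ⟨v, rfl⟩
    rw [Matrix.mulVecLin_add]
    exact Submodule.add_mem_sup ⟨v, rfl⟩ ⟨v, rfl⟩
  exact (Submodule.finrank_mono h).trans
    (Submodule.finrank_add_le_finrank_add_finrank _ _)

/-- Grouping the terms by the value of `k` factors the matrix through `K ^ S`. -/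
theorem sum_fiber_rank_le {K α ι κ : Type*} [Field K] [Fintype α] [DecidableEq κ]
    (I : Finset ι) (S : Finset κ) (k : ι → κ) (hk : ∀ p ∈ I, k p ∈ S)
    (Y : κ → α → K) (R : ι → α → K) :
    (Matrix.of fun y z => ∑ p ∈ I, Y (k p) y * R p z : Matrix α α K).rank ≤ S.card := by
  have : (Matrix.of fun y z => ∑ p ∈ I, Y (k p) y * R p z : Matrix α α K) =
      (Matrix.of fun y (e : S) => Y e y) *
        (Matrix.of fun (e : S) z => ∑ p ∈ I with k p = e, R p z) := by
    ext y z
    simp only [Matrix.mul_apply, Matrix.of_apply, Finset.mul_sum]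
    rw [Finset.sum_coe_sort S fun e => ∑ p ∈ I with k p = e, Y e y * R p z,
      ← Finset.sum_fiberwise_of_maps_to hk]
    refine Finset.sum_congr rfl fun e _ => Finset.sum_congr rfl fun p hp => ?_
    rw [(Finset.mem_filter.1 hp).2]
  rw [this]
  exact (Matrix.rank_mul_le_left _ _).trans ((Matrix.rank_le_card_width _).trans (by simp))

/-- The slice rank bound: a diagonal `3`-tensor written as a sum of products
in each of which one factor comes from a fixed family of functions indexed by `S`. -/
theorem card_le_three_mul_of_diagonal_tensor {K α ι κ : Type*} [Field K] [Fintype α]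
    [DecidableEq α] (I : Finset ι) (S : Finset κ) (k₁ k₂ k₃ : ι → κ)
    (hk : ∀ p ∈ I, k₁ p ∈ S ∨ k₂ p ∈ S ∨ k₃ p ∈ S) (C : ι → K) (X Y Z : κ → α → K)
    (hdiag : ∀ x y z, ∑ p ∈ I, C p * (X (k₁ p) x * Y (k₂ p) y * Z (k₃ p) z) =
      if x = y ∧ y = z then 1 else 0) :
    Fintype.card α ≤ 3 * S.card := by
  classical
  obtain ⟨w, hw, hcard⟩ := exists_orthogonal_large_support S X
  let I₂ := I.filter fun p => k₁ p ∉ S ∧ k₂ p ∈ S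
  let I₃ := I.filter fun p => k₁ p ∉ S ∧ k₂ p ∉ S
  let W : ι → K := fun p => C p * ∑ x, w x * X (k₁ p) x
  -- Contracting the tensor with `w` kills the terms whose first factor lies in `S`; each remaining
  -- one has its second or third factor in `S`.
  have hsum : Matrix.diagonal w =
      (Matrix.of fun y z => ∑ p ∈ I₂, Y (k₂ p) y * (W p * Z (k₃ p) z)) +
      (Matrix.of fun z y => ∑ p ∈ I₃, Z (k₃ p) z * (W p * Y (k₂ p) y)).transpose := by
    ext y z
    have h1 : Matrix.diagonal w y z = ∑ x, w x * (if x = y ∧ y = z then 1 else 0) := by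
      by_cases h : y = z
      · simp [h]
      · simp [h]
    have h2 : ∑ x, w x * (if x = y ∧ y = z then (1 : K) else 0) =
        ∑ p ∈ I, W p * (Y (k₂ p) y * Z (k₃ p) z) := by
      simp only [← hdiag, Finset.mul_sum, W, Finset.sum_mul]
      rw [Finset.sum_comm]
      exact Finset.sum_congr rfl fun p _ => Finset.sum_congr rfl fun x _ => by ring
    rw [h1, h2, Matrix.add_apply, Matrix.transpose_apply, Matrix.of_apply, Matrix.of_apply,
      ← Finset.sum_filter_add_sum_filter_not I fun p => k₁ p ∈ S]
    have h3 : ∑ p ∈ I with k₁ p ∈ S, W p * (Y (k₂ p) y * Z (k₃ p) z) = 0 :=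
      Finset.sum_eq_zero fun p hp => by simp [W, hw _ (Finset.mem_filter.1 hp).2]
    rw [h3, zero_add, ← Finset.sum_filter_add_sum_filter_not _ fun p => k₂ p ∈ S,
      Finset.filter_filter, Finset.filter_filter]
    congr 1 <;> exact Finset.sum_congr rfl fun p _ => by ring
  have hr : (Matrix.diagonal w).rank ≤ S.card + S.card := by
    rw [hsum]
    refine (Matrix.rank_add_le_rank_add_rank _ _).trans (add_le_add ?_ ?_)
    · exact sum_fiber_rank_le I₂ S k₂ (fun p hp => (Finset.mem_filter.1 hp).2.2) Y _
    · rw [Matrix.rank_transpose]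
      refine sum_fiber_rank_le I₃ S k₃ (fun p hp => ?_) Z _
      have := Finset.mem_filter.1 hp
      exact ((hk p this.1).resolve_left this.2.1).resolve_left this.2.2
  rw [Matrix.rank_diagonal, Fintype.card_subtype] at hr
  omega

/-! ### Polynomial method for tricoloured sum-free sets -/

theorem one_sub_add_pow_expansion {K : Type*} [Field K] (n : ℕ) :
    ∃ C : ℕ × ℕ × ℕ → K, (∀ t, C t ≠ 0 → t.1 + t.2.1 + t.2.2 ≤ n) ∧ ∀ x y z : K,
      1 - (x + y + z) ^ n =
        ∑ t ∈ Finset.range (n + 1) ×ˢ Finset.range (n + 1) ×ˢ Finset.range (n + 1),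
          C t * (x ^ t.1 * y ^ t.2.1 * z ^ t.2.2) := by
  let D : ℕ × ℕ × ℕ → K := fun t =>
    if t.1 + t.2.1 + t.2.2 = n then (n.choose (t.1 + t.2.1) * (t.1 + t.2.1).choose t.1 : K) else 0
  let E : ℕ × ℕ × ℕ → K := fun t => if t = 0 then 1 else 0
  refine ⟨fun t => E t - D t, fun t ht => ?_, fun x y z => ?_⟩
  · by_contra! h
    have h1 : t ≠ 0 := by rintro rfl; simp at h
    simp [E, D, h1, h.ne'] at ht
  · simp only [sub_mul, Finset.sum_sub_distrib]
    congr 1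
    · rw [Finset.sum_eq_single (0 : ℕ × ℕ × ℕ)] <;> simp +contextual [E]
    · rw [add_pow]
      simp only [add_pow, Finset.sum_mul]
      rw [Finset.sum_sigma']
      refine Finset.sum_bij_ne_zero (fun p _ _ => (p.2, p.1 - p.2, n - p.1)) ?_ ?_ ?_ ?_
      · rintro ⟨a, b⟩ h -
        simp at h ⊢
        omega
      · rintro ⟨a, b⟩ h - ⟨a', b'⟩ h' - heq
        simp at h h' heq ⊢
        omega
      · rintro ⟨a, b, c⟩ h hne
        have habc : a + b + c = n := by
          by_contra h'
          simp [D, h'] at hne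
        have hc : n - (a + b) = c := by omega
        refine ⟨⟨a + b, a⟩, by simp; omega, ?_, by simp; omega⟩
        simp only [D, habc, if_true] at hne
        simp only [Nat.add_sub_cancel_left, hc]
        convert hne using 1
        ring
      · rintro ⟨a, b⟩ h -
        simp at h
        have : b + (a - b) = a := by omega
        simp only [D, this]
        rw [if_pos (by omega)]
        ring

/-- Tricoloured sum-free sets in `F^M` are exponentially small. -/
theorem card_le_three_mul_lowExponents {F α : Type*} [Field F] [Fintype F] [Fintype α] {M : ℕ}
    (f g h : α → Fin M → F) (H : ∀ a b c, f a + g b + h c = 0 ↔ a = b ∧ b = c) :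
    Fintype.card α ≤ 3 * (lowExponents (Fintype.card F - 1) M).card := by
  classical
  set n := Fintype.card F - 1 with hn
  obtain ⟨C, hC, hexp⟩ := one_sub_add_pow_expansion (K := F) n
  let B := Finset.range (n + 1) ×ˢ Finset.range (n + 1) ×ˢ Finset.range (n + 1)
  let I : Finset (Fin M → ℕ × ℕ × ℕ) :=
    (Fintype.piFinset fun _ => B).filter fun p => ∀ j, C (p j) ≠ 0
  let mono : (α → Fin M → F) → (Fin M → ℕ) → α → F := fun f e a => ∏ j, f a j ^ e j
  refine card_le_three_mul_of_diagonal_tensor I (lowExponents n M) (fun p j => (p j).1)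
    (fun p j => (p j).2.1) (fun p j => (p j).2.2) (fun p hp => ?_) (fun p => ∏ j, C (p j))
    (mono f) (mono g) (mono h) fun x y z => ?_
  · obtain ⟨hp1, hp2⟩ := Finset.mem_filter.1 hp
    have hB : ∀ j, (p j).1 < n + 1 ∧ (p j).2.1 < n + 1 ∧ (p j).2.2 < n + 1 := fun j => by
      simpa [B] using Fintype.mem_piFinset.1 hp1 j
    -- Total degree at most `n * M` forces one of the three weights to be at most a third of it.
    have hle : ∑ j, (p j).1 + ∑ j, (p j).2.1 + ∑ j, (p j).2.2 ≤ n * M := by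
      rw [← Finset.sum_add_distrib, ← Finset.sum_add_distrib]
      refine (Finset.sum_le_sum fun j _ => hC _ (hp2 j)).trans ?_
      simp [mul_comm]
    simp only [lowExponents, Finset.mem_filter, Fintype.mem_piFinset, Finset.mem_range,
      fun j => (hB j).1, fun j => (hB j).2.1, fun j => (hB j).2.2, implies_true, true_and]
    omega
  · have hprod : ∏ j, (1 - (f x j + g y j + h z j) ^ n) = if x = y ∧ y = z then 1 else 0 := by
      have hn0 : n ≠ 0 := by
        have := Fintype.one_lt_card (α := F)
        omega
      split_ifs with hxyz
      · have h0 := (H x y z).2 hxyz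
        refine Finset.prod_eq_one fun j _ => ?_
        have : f x j + g y j + h z j = 0 := congrFun h0 j
        simp [this, hn0]
      · have h0 : f x + g y + h z ≠ 0 := fun h' => hxyz ((H x y z).1 h')
        obtain ⟨j, hj⟩ := Function.ne_iff.1 h0
        refine Finset.prod_eq_zero (Finset.mem_univ j) ?_
        have hj' : f x j + g y j + h z j ≠ 0 := hj
        rw [FiniteField.pow_card_sub_one_eq_one _ hj', sub_self]
    rw [← hprod]
    simp only [hexp]
    rw [Finset.prod_univ_sum]
    refine Finset.sum_subset_zero_on_sdiff (Finset.filter_subset _ _) (fun p hp => ?_)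
      fun p _ => ?_
    · simp only [I, Finset.mem_sdiff, Finset.mem_filter, not_and, not_forall, not_not] at hp
      obtain ⟨j, hj⟩ := hp.2 hp.1
      exact Finset.prod_eq_zero (Finset.mem_univ j) (by simp [hj])
    · simp only [mono, Finset.prod_mul_distrib]

/-! ### From solution-free sets to the two bounds -/

/-- A solution of a zero-sum subsystem in `A`, extended by a fresh value, is constant on the parts
of a zero-sum partition of the set of its variables. -/
theorem HasNoNontrivialSolution.exists_part {R : Type*} [CommRing R] {s : ℕ}
    {c : Fin s → R} {A : Finset R} (hA : HasNoNontrivialSolution c A) (hcard : s < A.card)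
    (hc : ∑ i, c i = 0) {U : Finset (Fin s)} (hU : ∑ i ∈ U, c i = 0) {x : Fin s → R}
    (hxA : ∀ i ∈ U, x i ∈ A) (hx : ∑ i ∈ U, c i * x i = 0) {i : Fin s} (hi : i ∈ U) :
    ∃ T ⊆ U, i ∈ T ∧ ∑ j ∈ T, c j = 0 ∧ ∀ j ∈ T, x j = x i := by
  classical
  obtain ⟨a, haA, ha⟩ : ∃ a ∈ A, a ∉ Finset.univ.image x :=
    Finset.exists_mem_notMem_of_card_lt_card
      ((Finset.card_image_le.trans (by simp)).trans_lt hcard)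
  have hax : ∀ j, x j ≠ a := fun j h => ha (Finset.mem_image.2 ⟨j, Finset.mem_univ _, h⟩)
  let y : Fin s → R := fun j => if j ∈ U then x j else a
  have hyU : ∀ j ∈ U, y j = x j := fun j hj => if_pos hj
  have hyU' : ∀ j, j ∉ U → y j = a := fun j hj => if_neg hj
  have hcompl : ∑ j ∈ Uᶜ, c j = 0 := by
    have := Finset.sum_add_sum_compl U c
    rwa [hU, hc, zero_add] at this
  have hy : ∑ j, c j * y j = 0 := by
    rw [← Finset.sum_add_sum_compl U, Finset.sum_congr rfl fun j hj => by rw [hyU j hj], hx,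
      Finset.sum_congr rfl fun j hj => by rw [hyU' j (Finset.mem_compl.1 hj)],
      ← Finset.sum_mul, hcompl, zero_mul, zero_add]
  have hyA : ∀ j, y j ∈ A := fun j => by
    by_cases hj : j ∈ U
    · rw [hyU j hj]
      exact hxA j hj
    · rwa [hyU' j hj]
  obtain ⟨P, hP, -, hconst⟩ := hA y hyA hy
  -- Since `y` equals `a` off `U` and never on `U`, the part containing `i` stays inside `U`.
  obtain ⟨T, hT, hiT⟩ := P.exists_mem (Finset.mem_univ i)
  have hTU : T ⊆ U := fun j hj => by
    by_contra hjU
    have := hconst T hT i hiT j hj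
    rw [hyU i hi, hyU' j hjU] at this
    exact hax i this
  refine ⟨T, hTU, hiT, hP T hT, fun j hj => ?_⟩
  have := hconst T hT j hj i hiT
  rwa [hyU i hi, hyU j (hTU hj)] at this

theorem degree_sum_mul_lt {F ι : Type*} [Field F] {ℓ N : ℕ} {c : ι → F[X]} (T : Finset ι)
    (hℓ : ∀ i ∈ T, (c i).natDegree ≤ ℓ) {x : ι → F[X]} (hx : ∀ i ∈ T, x i ∈ degreeLT F N) :
    ∑ i ∈ T, c i * x i ∈ degreeLT F (N + ℓ) := by
  refine Submodule.sum_mem _ fun i hi => ?_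
  have := mem_degreeLT.1 (hx i hi)
  rw [mem_degreeLT]
  by_cases h0 : x i = 0
  · simp [h0]
  have h1 : (x i).natDegree < N := (natDegree_lt_iff_degree_lt h0).2 this
  refine degree_le_natDegree.trans_lt ?_
  have := natDegree_mul_le (p := c i) (q := x i)
  have := hℓ i hi
  exact_mod_cast (by omega : (c i * x i).natDegree < N + ℓ)

theorem eq_zero_of_mem_degreeLT {F : Type*} [Field F] {M : ℕ} {p : F[X]} (hp : p ∈ degreeLT F M)
    (h : ∀ j : Fin M, p.coeff j = 0) : p = 0 := by
  ext k
  by_cases hk : k < M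
  · exact h ⟨k, hk⟩
  · rw [coeff_zero]
    exact coeff_eq_zero_of_degree_lt ((mem_degreeLT.1 hp).trans_le (by exact_mod_cast not_lt.1 hk))

/-- An equation containing a minimal zero-sum set of at least three coefficients. -/
theorem HasNoNontrivialSolution.card_le_of_minimal {F : Type*} [Field F] [Fintype F] {s ℓ N : ℕ}
    {c : Fin s → F[X]} {A : Finset F[X]} (hA : HasNoNontrivialSolution c A) (hcard : s < A.card)
    (hAN : ∀ a ∈ A, a ∈ degreeLT F N) (hc : ∑ i, c i = 0) (hℓ : ∀ i, (c i).natDegree ≤ ℓ)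
    {T : Finset (Fin s)} (hT : ∑ i ∈ T, c i = 0) (h3 : 3 ≤ T.card)
    (hmin : ∀ T' ⊆ T, T'.Nonempty → ∑ i ∈ T', c i = 0 → T' = T) :
    A.card ≤ 3 * (lowExponents (Fintype.card F - 1) (N + ℓ)).card := by
  classical
  obtain ⟨i₁, h1, i₂, h2, i₃, h3, h12, h13, h23⟩ := Finset.two_lt_card.1 h3
  let U := (T.erase i₁).erase i₂
  have h2' : i₂ ∈ T.erase i₁ := Finset.mem_erase.2 ⟨h12.symm, h2⟩
  have h3' : i₃ ∈ U := by simp [U, h3, h13.symm, h23.symm]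
  let x : A → A → A → Fin s → F[X] := fun u v w i =>
    if i = i₁ then u else if i = i₂ then v else w
  have hsum : ∀ u v w, ∑ i ∈ T, c i * x u v w i = c i₁ * u + c i₂ * v + (∑ i ∈ U, c i) * w := by
    intro u v w
    rw [← Finset.add_sum_erase T _ h1, ← Finset.add_sum_erase _ _ h2', ← add_assoc,
      Finset.sum_mul]
    congr 1
    · simp [x, h12.symm]
    · refine Finset.sum_congr rfl fun i hi => ?_
      simp only [U, Finset.mem_erase] at hi
      simp [x, hi.1, hi.2.1]
  have hxA : ∀ u v w i, x u v w i ∈ A := by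
    intro u v w i
    simp only [x]
    split_ifs <;> exact Subtype.property _
  have key : ∀ u v w : A, c i₁ * u + c i₂ * v + (∑ i ∈ U, c i) * w = (0 : F[X]) ↔
      u = v ∧ v = w := by
    intro u v w
    constructor
    · intro h
      rw [← hsum] at h
      obtain ⟨T', hT'T, hi, h0, hx⟩ :=
        hA.exists_part hcard hc hT (fun i _ => hxA u v w i) h h1
      obtain rfl := hmin T' hT'T ⟨_, hi⟩ h0
      have e2 := hx i₂ h2
      have e3 := hx i₃ h3
      simp only [x, h12.symm, h13.symm, h23.symm, if_true, if_false] at e2 e3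
      exact ⟨Subtype.ext e2.symm, Subtype.ext (e2.trans e3.symm)⟩
    · rintro ⟨rfl, rfl⟩
      rw [← hsum]
      have : ∀ i, x u u u i = u := fun i => by simp [x]
      simp only [this, ← Finset.sum_mul, hT, zero_mul]
  have := card_le_three_mul_lowExponents (F := F) (M := N + ℓ)
    (fun (u : A) j => (c i₁ * u).coeff j) (fun v j => (c i₂ * v).coeff j)
    (fun w j => ((∑ i ∈ U, c i) * w).coeff j) fun u v w => by
      rw [← key]
      constructor
      · intro h
        refine eq_zero_of_mem_degreeLT (M := N + ℓ) ?_ fun j => ?_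
        · rw [← hsum]
          exact degree_sum_mul_lt T (fun i _ => hℓ i) fun i _ => hAN _ (hxA u v w i)
        · rw [coeff_add, coeff_add]
          exact congrFun h j
      · intro h
        ext j
        have h' := congrArg (fun p => p.coeff (j : ℕ)) h
        simp only [coeff_add] at h'
        exact h'
  simpa using this

/-- An equation containing two disjoint pairs of opposite coefficients. -/
theorem HasNoNontrivialSolution.card_mul_card_sub_one_le_of_pairs {F : Type*} [Field F] [Fintype F]
    {s ℓ N : ℕ} {c : Fin s → F[X]} {A : Finset F[X]} (hA : HasNoNontrivialSolution c A)
    (hcard : s < A.card) (hAN : ∀ a ∈ A, a ∈ degreeLT F N) (hc0 : ∀ i, c i ≠ 0)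
    (hc : ∑ i, c i = 0) (hℓ : ∀ i, (c i).natDegree ≤ ℓ) {i i' j j' : Fin s}
    (hi : c i + c i' = 0) (hj : c j + c j' = 0) (hii' : i ≠ i') (hjj' : j ≠ j')
    (hij : i ≠ j) (hij' : i ≠ j') (hi'j : i' ≠ j) (hi'j' : i' ≠ j') :
    A.card * (A.card - 1) ≤ 2 * Fintype.card F ^ (N + ℓ) := by
  classical
  let f : F[X] × F[X] → F[X] := fun p => c i * p.1 + c j * p.2
  let G : F[X] × F[X] → Fin (N + ℓ) → F := fun p k => (f p).coeff k
  have hfA : ∀ p ∈ A.offDiag, f p ∈ degreeLT F (N + ℓ) := fun p hp => by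
    obtain ⟨hp1, hp2, -⟩ := Finset.mem_offDiag.1 hp
    have := degree_sum_mul_lt (N := N) (ℓ := ℓ) (c := ![c i, c j]) (x := ![p.1, p.2]) Finset.univ
      (by simp [Fin.forall_fin_two, hℓ]) (by simp [Fin.forall_fin_two, hAN _ hp1, hAN _ hp2])
    simpa [f] using this
  have hG : ∀ p ∈ A.offDiag, ∀ r ∈ A.offDiag, G p = G r → f p = f r := by
    intro p hp r hr h
    refine sub_eq_zero.1 (eq_zero_of_mem_degreeLT (Submodule.sub_mem _ (hfA p hp) (hfA r hr))
      fun k => ?_)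
    rw [coeff_sub, sub_eq_zero]
    exact congrFun h k
  -- A collision `f p = f r` solves the four-variable equation. The part of `i` has a second element
  -- because `c i ≠ 0`; it is not `j`, as `p` is off the diagonal, so `p.1` occurs in `r`.
  have hcoll : ∀ p ∈ A.offDiag, ∀ r ∈ A.offDiag, f p = f r → r.1 = p.1 ∨ r.2 = p.1 := by
    intro p hp r hr h
    obtain ⟨hp1, hp2, hp12⟩ := Finset.mem_offDiag.1 hp
    obtain ⟨hr1, hr2, -⟩ := Finset.mem_offDiag.1 hr
    let x : Fin s → F[X] := fun k =>
      if k = i then p.1 else if k = i' then r.1 else if k = j then p.2 else r.2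
    have xi : x i = p.1 := by simp [x]
    have xi' : x i' = r.1 := by simp [x, hii'.symm]
    have xj : x j = p.2 := by simp [x, hij.symm, hi'j.symm]
    have xj' : x j' = r.2 := by simp [x, hij'.symm, hi'j'.symm, hjj'.symm]
    have hsum : ∀ g : Fin s → F[X],
        ∑ k ∈ ({i, i', j, j'} : Finset (Fin s)), g k = g i + (g i' + (g j + g j')) := by
      intro g
      rw [Finset.sum_insert (by simp [hii', hij, hij']), Finset.sum_insert (by simp [hi'j, hi'j']),
        Finset.sum_pair hjj']
    have hxA : ∀ k ∈ ({i, i', j, j'} : Finset (Fin s)), x k ∈ A := by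
      intro k _
      simp only [x]
      split_ifs <;> assumption
    have hx0 : ∑ k ∈ ({i, i', j, j'} : Finset (Fin s)), c k * x k = 0 := by
      rw [hsum, xi, xi', xj, xj', eq_neg_of_add_eq_zero_right hi, eq_neg_of_add_eq_zero_right hj]
      have h' : c i * p.1 + c j * p.2 = c i * r.1 + c j * r.2 := h
      linear_combination h'
    obtain ⟨T, hTU, hiT, hT0, hTx⟩ := hA.exists_part hcard hc (i := i)
      (by rw [hsum]; linear_combination hi + hj) hxA hx0 (by simp)
    obtain ⟨k, hk, hki⟩ : ∃ k ∈ T, k ≠ i := by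
      by_contra! hT
      have : T = {i} := Finset.eq_singleton_iff_unique_mem.2 ⟨hiT, hT⟩
      exact hc0 i (by simpa [this] using hT0)
    have hxk := hTx k hk
    have hkU := hTU hk
    simp only [Finset.mem_insert, Finset.mem_singleton, hki, false_or] at hkU
    rcases hkU with rfl | rfl | rfl
    · left; rw [← xi', hxk, xi]
    · exact absurd (by rw [← xj, hxk, xi]) hp12
    · right; rw [← xj', hxk, xi]
  have hinj₁ : ∀ p r : F[X] × F[X], f p = f r → p.1 = r.1 → p = r := by
    intro p r h h1
    refine Prod.ext h1 (mul_left_cancel₀ (hc0 j) ?_)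
    simpa [f, h1] using h
  have hinj₂ : ∀ p r : F[X] × F[X], f p = f r → p.2 = r.2 → p = r := by
    intro p r h h2
    refine Prod.ext (mul_left_cancel₀ (hc0 i) ?_) h2
    simpa [f, h2] using h
  have hfib : ∀ v ∈ (Finset.univ : Finset (Fin (N + ℓ) → F)),
      (A.offDiag.filter fun p => G p = v).card ≤ 2 := by
    intro v _
    by_contra! h
    obtain ⟨p, hp, r, hr, t, ht, hpr, hpt, hrt⟩ := Finset.two_lt_card.1 h
    simp only [Finset.mem_filter] at hp hr ht
    have epr := hG p hp.1 r hr.1 (hp.2.trans hr.2.symm)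
    have ept := hG p hp.1 t ht.1 (hp.2.trans ht.2.symm)
    -- Two further points of the fibre would both have second coordinate `p.1`, and so coincide.
    have hr' : r.2 = p.1 := (hcoll p hp.1 r hr.1 epr).resolve_left fun h' =>
      hpr (hinj₁ p r epr h'.symm)
    have ht' : t.2 = p.1 := (hcoll p hp.1 t ht.1 ept).resolve_left fun h' =>
      hpt (hinj₁ p t ept h'.symm)
    exact hrt (hinj₂ r t (epr.symm.trans ept) (hr'.trans ht'.symm))
  have := Finset.card_le_mul_card_image_of_maps_to (f := G) (fun p _ => Finset.mem_univ (G p)) 2 hfib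
  rw [Finset.offDiag_card] at this
  simpa [Nat.mul_sub] using this

theorem exists_minimal_zero_sum {R ι : Type*} [AddCommMonoid R] {c : ι → R} {W : Finset ι}
    (hne : W.Nonempty) (hW : ∑ i ∈ W, c i = 0) :
    ∃ T ⊆ W, T.Nonempty ∧ ∑ i ∈ T, c i = 0 ∧
      ∀ T' ⊆ T, T'.Nonempty → ∑ i ∈ T', c i = 0 → T' = T := by
  obtain ⟨T, hTW, hT⟩ := exists_minimal_le_of_wellFoundedLT
    (fun T : Finset ι => T.Nonempty ∧ ∑ i ∈ T, c i = 0) W ⟨hne, hW⟩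
  exact ⟨T, hTW, hT.prop.1, hT.prop.2, fun T' h h1 h2 =>
    Finset.Subset.antisymm h (hT.le_of_le ⟨h1, h2⟩ h)⟩

/-- The equation contains a minimal zero-sum set of at least three coefficients or two disjoint
pairs of opposite coefficients, and each of these bounds the size of a solution-free set. -/
theorem HasNoNontrivialSolution.card_le {F : Type*} [Field F] [Fintype F] {s ℓ N : ℕ}
    {c : Fin s → F[X]} {A : Finset F[X]} (hA : HasNoNontrivialSolution c A) (hs : 3 ≤ s)
    (hAN : ∀ a ∈ A, a ∈ degreeLT F N) (hc0 : ∀ i, c i ≠ 0)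
    (hc : ∑ i, c i = 0) (hℓ : ∀ i, (c i).natDegree ≤ ℓ) :
    A.card ≤ s ∨ A.card ≤ 3 * (lowExponents (Fintype.card F - 1) (N + ℓ)).card ∨
      A.card * (A.card - 1) ≤ 2 * Fintype.card F ^ (N + ℓ) := by
  classical
  by_cases hcard : A.card ≤ s
  · exact Or.inl hcard
  rw [not_le] at hcard
  have step : ∀ W : Finset (Fin s), W.Nonempty → ∑ i ∈ W, c i = 0 →
      A.card ≤ 3 * (lowExponents (Fintype.card F - 1) (N + ℓ)).card ∨
      ∃ i i', i ≠ i' ∧ {i, i'} ⊆ W ∧ c i + c i' = 0 := by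
    intro W hne hW
    obtain ⟨T, hTW, hTne, hT, hmin⟩ := exists_minimal_zero_sum hne hW
    by_cases h3 : 3 ≤ T.card
    · exact Or.inl (hA.card_le_of_minimal hcard hAN hc hℓ hT h3 hmin)
    have h1 : T.card ≠ 1 := by
      intro h
      obtain ⟨i, rfl⟩ := Finset.card_eq_one.1 h
      exact hc0 i (by simpa using hT)
    have h0 := hTne.card_pos
    obtain ⟨i, i', hii', rfl⟩ := Finset.card_eq_two.1 (show T.card = 2 by omega)
    exact Or.inr ⟨i, i', hii', hTW, by rwa [Finset.sum_pair hii'] at hT⟩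
  right
  rcases step Finset.univ ⟨⟨0, by omega⟩, Finset.mem_univ _⟩ hc with h | ⟨i, i', hii', -, hi⟩
  · exact Or.inl h
  have hsum : ∑ k ∈ ({i, i'} : Finset (Fin s))ᶜ, c k = 0 := by
    have := Finset.sum_add_sum_compl {i, i'} c
    rwa [hc, Finset.sum_pair hii', hi, zero_add] at this
  have hne : (({i, i'} : Finset (Fin s))ᶜ).Nonempty := by
    rw [← Finset.card_pos, Finset.card_compl, Finset.card_pair hii', Fintype.card_fin]
    omega
  rcases step _ hne hsum with h | ⟨j, j', hjj', hsub, hj⟩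
  · exact Or.inl h
  have hj1 := hsub (Finset.mem_insert_self j _)
  have hj2 := hsub (Finset.mem_insert_of_mem (Finset.mem_singleton_self j'))
  simp only [Finset.mem_compl, Finset.mem_insert, Finset.mem_singleton, not_or] at hj1 hj2
  exact Or.inr (hA.card_mul_card_sub_one_le_of_pairs hcard hAN hc0 hc hℓ hi hj hii' hjj'
    (Ne.symm hj1.1) (Ne.symm hj2.1) (Ne.symm hj1.2) (Ne.symm hj2.2))

/-! ### Exponential bound and conclusion -/

/-- Solution-free sets are exponentially small. -/
theorem exists_maxSolutionFree_le_mul_pow {q s : ℕ} (ℓ : ℕ) (hq : 2 ≤ q) (hs : 3 ≤ s) :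
    ∃ K σ : ℝ, 0 < K ∧ 0 < σ ∧ σ < q ∧
      ∀ (F : Type*) [Field F] [Finite F], Nat.card F = q →
      ∀ c : Fin s → F[X], (∀ i, c i ≠ 0) → ∑ i, c i = 0 → (∀ i, (c i).natDegree ≤ ℓ) →
      ∀ N : ℕ, (maxSolutionFree c N : ℝ) ≤ K * σ ^ N := by
  obtain ⟨ρ, hρ0, hρq, hρ⟩ := exists_lowExponents_card_le (n := q - 1) (by omega)
  have hq1 : (1 : ℝ) < q := by exact_mod_cast hq
  have hρq' : ρ < q := by
    have : ((q - 1 : ℕ) : ℝ) + 1 = q := by exact_mod_cast Nat.sub_add_cancel (by omega : 1 ≤ q)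
    rwa [this] at hρq
  have hsq1 : (1 : ℝ) ≤ √q := Real.one_le_sqrt.2 hq1.le
  have hsq : √(q : ℝ) < q := (Real.sqrt_lt' (by positivity)).2 (by nlinarith)
  have hσ1 : 1 ≤ max ρ √q := hsq1.trans (le_max_right _ _)
  -- One summand for each alternative of `HasNoNontrivialSolution.card_le`; `√q ≥ 1` makes the base
  -- at least `1`, which absorbs the case `|A| ≤ s`.
  refine ⟨s + 3 * ρ ^ ℓ + 2 * √q ^ ℓ, max ρ √q, by positivity, one_pos.trans_le hσ1,
    max_lt hρq' hsq, ?_⟩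
  intro F _ _ hF c hc0 hc hℓ N
  have := Fintype.ofFinite F
  obtain ⟨A, hAN, hA, hcard⟩ := (isGreatest_maxSolutionFree (by omega : 1 ≤ s) c N).1
  rw [← hcard]
  rw [Nat.card_eq_fintype_card] at hF
  have hσN : (1 : ℝ) ≤ max ρ √q ^ N := one_le_pow₀ hσ1
  have hρN : ρ ^ (N + ℓ) ≤ ρ ^ ℓ * max ρ √q ^ N := by
    rw [pow_add, mul_comm]
    gcongr
    exact le_max_left _ _
  have hqN : √(q : ℝ) ^ (N + ℓ) ≤ √(q : ℝ) ^ ℓ * max ρ √q ^ N := by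
    rw [pow_add, mul_comm]
    gcongr
    exact le_max_right _ _
  have t1 : (0 : ℝ) ≤ s * max ρ √q ^ N := by positivity
  have t2 : 0 ≤ ρ ^ ℓ * max ρ √q ^ N := by positivity
  have t3 : 0 ≤ √(q : ℝ) ^ ℓ * max ρ √q ^ N := by positivity
  have t4 : (s : ℝ) ≤ s * max ρ √q ^ N := le_mul_of_one_le_right (by positivity) hσN
  have hcases := hA.card_le hs hAN hc0 hc hℓ
  rw [hF] at hcases
  have hgoal : ∀ a : ℝ, a ≤ s ∨ a ≤ 3 * ρ ^ (N + ℓ) ∨ a ≤ 2 * √(q : ℝ) ^ (N + ℓ) →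
      a ≤ (s + 3 * ρ ^ ℓ + 2 * √(q : ℝ) ^ ℓ) * max ρ √q ^ N := by
    rintro a (h | h | h) <;> linarith
  apply hgoal
  by_cases hAs : A.card ≤ s
  · exact Or.inl (by exact_mod_cast hAs)
  rcases hcases with h | h | h
  · exact absurd h hAs
  · have h' : (A.card : ℝ) ≤ 3 * (lowExponents (q - 1) (N + ℓ)).card := by exact_mod_cast h
    exact Or.inr (Or.inl (h'.trans (by gcongr; exact hρ _)))
  · refine Or.inr (Or.inr ?_)
    have h2 : A.card * A.card ≤ 4 * q ^ (N + ℓ) := by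
      have : A.card * A.card ≤ 2 * (A.card * (A.card - 1)) := by
        rw [mul_left_comm]
        exact Nat.mul_le_mul_left _ (by omega)
      omega
    rw [← pow_le_pow_iff_left₀ (by positivity) (by positivity) two_ne_zero, mul_pow, ← pow_mul,
      mul_comm _ 2, pow_mul, Real.sq_sqrt (by positivity), sq (A.card : ℝ)]
    norm_num
    exact_mod_cast h2

theorem exists_pow_mul_pow_le {θ : ℝ} (h0 : 0 ≤ θ) (h1 : θ < 1) (k : ℕ) :
    ∃ B : ℝ, 0 < B ∧ ∀ N : ℕ, (N : ℝ) ^ k * θ ^ N ≤ B := by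
  have ht := tendsto_pow_const_mul_const_pow_of_abs_lt_one k (abs_lt.2 ⟨by linarith, h1⟩)
  obtain ⟨B, hB⟩ := ht.bddAbove_range
  exact ⟨max B 1, by positivity, fun N => (hB ⟨N, rfl⟩).trans (le_max_left _ _)⟩

theorem theorem2 (q s ℓ : ℕ) (hs : 3 ≤ s) :
    ∃ C : ℝ, 0 < C ∧
      ∀ (F : Type*) [Field F] [Finite F], Nat.card F = q →
      ∀ c : Fin s → F[X], (∀ i, c i ≠ 0) → ∑ i, c i = 0 → 1 ≤ genus c →
        (Finset.univ.sup fun i => (c i).natDegree) = ℓ →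
      ∀ N : ℕ, 2 ≤ N →
        (maxSolutionFree c N : ℝ) ≤
          C * ((q : ℝ) ^ N * ((Real.log N) ^ 4 / (N : ℝ)) ^ (s - 2)) := by
  by_cases hq : 2 ≤ q
  swap
  · refine ⟨1, one_pos, fun F _ _ hF => absurd ?_ hq⟩
    rw [← hF]
    exact Finite.one_lt_card
  obtain ⟨K, σ, hK, hσ0, hσq, hmain⟩ := exists_maxSolutionFree_le_mul_pow ℓ hq hs
  have hq0 : (0 : ℝ) < q := hσ0.trans hσq
  obtain ⟨B, hB0, hB⟩ := exists_pow_mul_pow_le (div_pos hσ0 hq0).le ((div_lt_one hq0).2 hσq) (s - 2)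
  have hlog2 : 0 < Real.log 2 := Real.log_pos one_lt_two
  -- `B` bounds `N ^ (s - 2) * (σ / q) ^ N`; dividing by the power of `log 2` pays for `log N ≥ log
  -- 2`.
  refine ⟨K * B / (Real.log 2 ^ 4) ^ (s - 2), by positivity, ?_⟩
  intro F _ _ hF c hc0 hc _ hℓ N hN
  refine (hmain F hF c hc0 hc (fun i => hℓ ▸ Finset.le_sup (f := fun i => (c i).natDegree)
    (Finset.mem_univ i)) N).trans ?_
  have hN0 : (0 : ℝ) < N := by exact_mod_cast (by omega : 0 < N)
  have hlog : Real.log 2 ≤ Real.log N := Real.log_le_log two_pos (by exact_mod_cast hN)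
  have hσN : σ ^ N ≤ B * q ^ N / N ^ (s - 2) := by
    have := hB N
    rw [div_pow, mul_div_assoc', div_le_iff₀ (by positivity)] at this
    rw [le_div_iff₀ (by positivity)]
    linarith
  calc K * σ ^ N ≤ K * (B * q ^ N / N ^ (s - 2)) := by gcongr
    _ = K * B / (Real.log 2 ^ 4) ^ (s - 2) * (q ^ N * (Real.log 2 ^ 4 / N) ^ (s - 2)) := by
        rw [div_pow]
        field_simp
    _ ≤ _ := by gcongr
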